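/- Let $n,s,t\in\mathbb N$, $N=2^n$, and let $\varepsilon\in\mathbb R$. Let $\alpha^{(1)},\dots,\alpha^{(s)}\in\mathbb C^{\{0,1\}^n}$ be orthonormal vectors (pure states) that are $\varepsilon$-flat, i.e. $|\alpha^{(j)}_x|^2\le\varepsilon$ for all $j\in[s]$ and $x\in\{0,1\}^n$. For $g:\{0,1\}^n\to\{\pm1\}$ and a permutation $\pi$ of $\{0,1\}^n$ let $U_g|x\rangle=g(x)|x\rangle$ and $U_\pi|x\rangle=|\pi(x)\rangle$, and put $$\rho=\mathbb E_{g,\pi}\Big[(U_\pi U_g)^{\otimes st}\Big(\bigotimes_{j\in[s]}\big(|\alpha^{(j)}\rangle\langle\alpha^{(j)}|\big)^{\otimes t}\Big)(U_g^\dagger U_\pi^\dagger)^{\otimes st}\Big],$$ where $g$ is a uniformly random function and $\pi$ an independent, uniformly random permutation. Let $$\rho_{\mathrm{uni}}=\frac1{N(N-1)\cdots(N-st+1)}\sum_{z}\sum_{\sigma\in S_t^s}|z\rangle\langle\sigma(z)|,$$ where $z$ runs over the tuples $(z_{j,i})_{j\in[s],i\in[t]}$ of pairwise distinct elements of $\{0,1\}^n$,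 and $\sigma=(\sigma_1,\dots,\sigma_s)\in S_t^s$ permutes the entries within each block, $\sigma(z)_{j,i}=z_{j,\sigma_j(i)}$ (if $st>N$ the sum is empty and $\rho_{\mathrm{uni}}$ is read as $0$). Then $$\|\rho-\rho_{\mathrm{uni}}\|_1\le C\big((st)^2\varepsilon+N s^6t^4\varepsilon^2\big)$$ for a universal constant $C>0$ (independent of $n,s,t,\varepsilon$ and the vectors), where $\|A\|_1=\mathrm{Tr}\sqrt{AA^\dagger}$ is the trace norm. -/

import Mathlib

open scoped BigOperators Matrix

noncomputable section

/-- Computational basis labels of `n` qubits, that is `{0,1}^n`. -/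
abbrev BitString (n : ℕ) : Type := Fin n → Bool

/-- Positions in an `st`-tuple, organised in `s` blocks of length `t`. -/
abbrev BlockIndex (s t : ℕ) : Type := Fin s × Fin t

/-- `st`-tuples of `n`-bit strings: basis labels of `st` registers of `n` qubits each. -/
abbrev Tuple (n s t : ℕ) : Type := BlockIndex s t → BitString n

/-- Operators on `st` registers of `n` qubits each, in the computational basis. -/
abbrev RegisterOp (n s t : ℕ) : Type := Matrix (Tuple n s t) (Tuple n s t) ℂ

/-- The trace norm `‖A‖₁ = Tr √(A A†)`; the square root is the one of the continuous functional
calculus of Hermitian matrices (and the trace is a real number). -/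
def traceNorm {m : Type*} [Fintype m] [DecidableEq m] (A : Matrix m m ℂ) : ℝ :=
  (Matrix.trace (cfc Real.sqrt (A * Aᴴ))).re

/-- A vector is `ε`-flat if every computational basis coefficient `α_x` has `|α_x|² ≤ ε`. -/
def IsFlat {n : ℕ} (ε : ℝ) (α : EuclideanSpace ℂ (BitString n)) : Prop :=
  ∀ x : BitString n, ‖α x‖ ^ 2 ≤ ε

/-- The rank-one operator `|α⟩⟨α|`. -/
def ketBra {n : ℕ} (α : EuclideanSpace ℂ (BitString n)) :
    Matrix (BitString n) (BitString n) ℂ :=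
  Matrix.of fun x y => α x * star (α y)

/-- The tensor product `⨂ᵢ Bᵢ` of operators on `n` qubits over all `st` registers. -/
def tensorOp {n s t : ℕ} (B : BlockIndex s t → Matrix (BitString n) (BitString n) ℂ) :
    RegisterOp n s t :=
  Matrix.of fun z z' => ∏ v, B v (z v) (z' v)

/-- The phase unitary `U_g |x⟩ = g(x) |x⟩` of a function `g : {0,1}^n → {±1}`. -/
def phaseOp {n : ℕ} (g : BitString n → ℤˣ) : Matrix (BitString n) (BitString n) ℂ :=
  Matrix.diagonal fun x => ((g x : ℤ) : ℂ)

/-- The permutation unitary `U_π |x⟩ = |π(x)⟩`. -/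
def permOp {n : ℕ} (π : Equiv.Perm (BitString n)) : Matrix (BitString n) (BitString n) ℂ :=
  Matrix.of fun y x => if y = π x then 1 else 0

/-- The input state `⨂_{j ∈ [s]} |α_j⟩⟨α_j|^{⊗ t}`. -/
def inputState {n s : ℕ} (t : ℕ) (α : Fin s → EuclideanSpace ℂ (BitString n)) :
    RegisterOp n s t :=
  tensorOp fun v => ketBra (α v.1)

/-- The averaged output state
`ρ = 𝔼_{g,π} (U_π U_g)^{⊗ st} (⨂_j |α_j⟩⟨α_j|^{⊗ t}) (U_g† U_π†)^{⊗ st}`, where `g` and `π` are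
independent and uniform. -/
def outputState {n s : ℕ} (t : ℕ) (α : Fin s → EuclideanSpace ℂ (BitString n)) :
    RegisterOp n s t :=
  𝔼 g : BitString n → ℤˣ, 𝔼 π : Equiv.Perm (BitString n),
    tensorOp (fun _ : BlockIndex s t => permOp π * phaseOp g) * inputState t α *
      tensorOp (fun _ : BlockIndex s t => (phaseOp g)ᴴ * (permOp π)ᴴ)

/-- The index permutation `(j, i) ↦ (j, σ_j(i))` of an element `σ` of `S_t^s`. -/
def blockPerm {s t : ℕ} (σ : Fin s → Equiv.Perm (Fin t)) : Equiv.Perm (BlockIndex s t) :=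
  Equiv.prodCongrRight σ

/-- `ρ_uni = (1 / (N (N-1) ⋯ (N-st+1))) ∑_z ∑_{σ ∈ S_t^s} |z⟩⟨σ(z)|` with `N = 2^n`, where `z` runs
over the `st`-tuples with pairwise distinct entries and `σ(z)_v = z_{σ(v)}`. -/
def uniState (n s t : ℕ) : RegisterOp n s t :=
  (((2 ^ n).descFactorial (s * t) : ℕ) : ℂ)⁻¹ •
    ∑ z : BlockIndex s t ↪ BitString n, ∑ σ : Fin s → Equiv.Perm (Fin t),
      Matrix.single (z : Tuple n s t) (fun v => z (blockPerm σ v)) 1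

end

/-! By duality the trace norm equals `Re tr(W (ρ - ρ_uni))` for some contraction `W`, so it suffices
to bound such traces.

The random signs kill every entry between a tuple `z` of distinct strings and a tuple that is not a
rearrangement of `z`. Hence `ρ` splits into a collision part, bounded by the collision probability
`1 - δ ≤ (st)²ε`, and a part on distinct tuples. There the random permutation makes the entry at
`(z, z ∘ τ)` independent of `z`, and it depends on `τ` only through the colouring `f v = (τ.symm
v).1`. The distinct part of `tr(W ρ)` is therefore `∑ f, overlap α f * colourTerm W f` with
`‖colourTerm W f‖ ≤ 1`; the colouring `Prod.fst` contributes `δ · tr(W ρ_uni)`, and the other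
overlaps are the error.

If `f` recolours `d` positions, orthogonality makes `d` factors of the overlap sum to zero. Over
distinct tuples such a factor survives only through a collision with another position; this costs
`st · ε` and uses up at most two zero-sum factors (`norm_injSum_le_pow`), so the overlap is at most
`(st√ε)^d` when `st√ε ≤ 1`. Colourings that occur have `d = 0` or `d ≥ 2`. Counting them gives an
error of order `(s · st · st√ε)² = s⁶t⁴ε`, at most `N s⁶t⁴ε²` because flatness forces `Nε ≥ 1`. When
`s⁶t⁴ε > 1` the trivial bound 2 suffices. -/

/-! ### Sums over tuples of distinct points -/

/-- The sum of `∏ v, f v (z v)` over the tuples `z` with pairwise distinct entries. -/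
noncomputable def injSum {V X R : Type*} [Fintype V] [DecidableEq V] [Fintype X] [DecidableEq X] [CommRing R]
    (f : V → X → R) : R :=
  ∑ z : V ↪ X, ∏ v, f v (z v)

theorem prod_update_apply {V X R : Type*} [Fintype V] [DecidableEq V] [CommRing R]
    (f : V → X → R) (w : V) (h : X → R) (z : V → X) :
    ∏ v, Function.update f w h v (z v) = h (z w) * ∏ v ∈ Finset.univ.erase w, f v (z v) := by
  rw [← Finset.mul_prod_erase Finset.univ _ (Finset.mem_univ w), Function.update_self]
  congr 1
  exact Finset.prod_congr rfl fun v hv => by rw [Function.update_of_ne (Finset.ne_of_mem_erase hv)]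

section InjSum

variable {V X R : Type*} [Fintype V] [DecidableEq V] [Fintype X] [DecidableEq X] [CommRing R]

theorem injSum_congr_equiv {V' : Type*} [Fintype V'] [DecidableEq V'] (e : V' ≃ V)
    (f : V → X → R) : injSum (fun v' => f (e v')) = injSum f := by
  unfold injSum
  refine Fintype.sum_equiv (Equiv.embeddingCongr e (Equiv.refl X)) _ _ fun z => ?_
  refine Fintype.prod_equiv e _ _ fun v => ?_
  simp

/-- The coordinate `none` ranges over the complement of the values already used, and these are
distinct, so its sum is the full sum minus the used terms. -/
theorem injSum_option (f : Option V → X → R) :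
    injSum f = ∑ z : V ↪ X, (∏ v, f (some v) (z v)) *
      (∑ x, f none x - ∑ v, f none (z v)) := by
  unfold injSum
  rw [Fintype.sum_equiv (Function.Embedding.optionEmbeddingEquiv V X) _
    (fun p : Σ z : V ↪ X, ↥(Set.range z)ᶜ => (∏ v, f (some v) (p.1 v)) * f none p.2)]
  · rw [Fintype.sum_sigma]
    refine Finset.sum_congr rfl fun z _ => ?_
    change ∑ y : ↥(Set.range z)ᶜ, (∏ v, f (some v) (z v)) * f none y = _
    rw [← Finset.mul_sum]
    congr 1
    have h1 : ∑ x : ↥(Set.range z)ᶜ, f none x = ∑ x ∈ (Finset.univ.map z)ᶜ, f none x := by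
      refine (Finset.sum_subtype _ (fun x => ?_) _).symm
      simp
    rw [h1, eq_sub_iff_add_eq, ← Finset.sum_map Finset.univ z (fun x => f none x)]
    exact Finset.sum_compl_add_sum _ _
  · intro z
    rw [Fintype.prod_option, mul_comm]
    rfl

theorem injSum_option_of_sum_eq_zero (f : Option V → X → R) (h : ∑ x, f none x = 0) :
    injSum f = -∑ w : V, injSum
      (Function.update (fun v => f (some v)) w fun x => f none x * f (some w) x) := by
  rw [injSum_option, h]
  unfold injSum
  rw [Finset.sum_comm, ← Finset.sum_neg_distrib]
  refine Finset.sum_congr rfl fun z _ => ?_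
  rw [zero_sub, mul_neg, Finset.mul_sum]
  congr 1
  refine Finset.sum_congr rfl fun w _ => ?_
  rw [prod_update_apply, ← Finset.mul_prod_erase Finset.univ _ (Finset.mem_univ w)]
  ring

theorem injSum_update_smul (f : V → X → R) (w : V) (c : R) (h : X → R) :
    injSum (Function.update f w fun x => c * h x) = c * injSum (Function.update f w h) := by
  unfold injSum
  rw [Finset.mul_sum]
  refine Finset.sum_congr rfl fun z _ => ?_
  rw [prod_update_apply, prod_update_apply, mul_assoc]

theorem injSum_le_one (p : V → X → ℝ) (h0 : ∀ v x, 0 ≤ p v x) (h1 : ∀ v, ∑ x, p v x ≤ 1) :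
    injSum p ≤ 1 := by
  calc injSum p = ∑ z ∈ Finset.univ.image (fun z : V ↪ X => (z : V → X)), ∏ v, p v (z v) := by
        rw [Finset.sum_image fun a _ b _ h => DFunLike.coe_injective h]; rfl
    _ ≤ ∑ z : V → X, ∏ v, p v (z v) :=
        Finset.sum_le_sum_of_subset_of_nonneg (Finset.subset_univ _)
          fun z _ _ => Finset.prod_nonneg fun v _ => h0 _ _
    _ = ∏ v, ∑ x, p v x := by rw [Fintype.prod_sum]
    _ ≤ 1 := Finset.prod_le_one (fun v _ => Finset.sum_nonneg fun x _ => h0 _ _) fun v _ => h1 v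

theorem norm_injSum_le_one (f : V → X → ℂ) (h1 : ∀ v, ∑ x, ‖f v x‖ ≤ 1) : ‖injSum f‖ ≤ 1 := by
  refine le_trans ?_ (injSum_le_one (fun v x => ‖f v x‖) (fun _ _ => norm_nonneg _) h1)
  unfold injSum
  refine (norm_sum_le _ _).trans (le_of_eq ?_)
  simp [norm_prod]

end InjSum

/-- Eliminating a zero-sum position `v` merges its factor into one of at most `m` others, at cost
`ε` each. The merge destroys at most two zero-sum positions, so each of them is worth a factor
`m√ε`. Strong induction is needed because their number drops by one or two. -/
theorem norm_injSum_le_pow {X : Type*} [Fintype X] [DecidableEq X] {ε : ℝ} (hε : 0 < ε) (m : ℕ)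
    (hm : (m : ℝ) * √ε ≤ 1) (r : ℕ) : ∀ (V : Type) [Fintype V] [DecidableEq V]
    (f : V → X → ℂ) (D : Finset V), Fintype.card V ≤ m → D.card = r →
    (∀ v, ∑ x, ‖f v x‖ ≤ 1) → (∀ v ∈ D, ∑ x, f v x = 0) → (∀ v ∈ D, ∀ x, ‖f v x‖ ≤ ε) →
    ‖injSum f‖ ≤ ((m : ℝ) * √ε) ^ r := by
  induction r using Nat.strong_induction_on with
  | _ r ih =>
  intro V _ _ f D hV hD h1 h0 hsup
  rcases D.eq_empty_or_nonempty with rfl | ⟨v, hv⟩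
  · simp only [Finset.card_empty] at hD
    subst hD
    simpa using norm_injSum_le_one f h1
  have hr : 1 ≤ r := hD ▸ Finset.card_pos.2 ⟨v, hv⟩
  have hm1 : (1 : ℝ) ≤ m := by
    have : 0 < Fintype.card V := Fintype.card_pos_iff.2 ⟨v⟩
    exact_mod_cast this.trans_le hV
  have hsq : √ε * √ε = ε := Real.mul_self_sqrt hε.le
  have hs0 : 0 < √ε := Real.sqrt_pos.2 hε
  set x : ℝ := (m : ℝ) * √ε with hx
  have hx0 : 0 ≤ x := by positivity
  let e : Option {w // w ≠ v} ≃ V := Equiv.optionSubtypeNe v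
  rw [← injSum_congr_equiv e f, injSum_option_of_sum_eq_zero]
  swap
  · simpa [e] using h0 v hv
  rw [norm_neg]
  have key : ∀ w : {w // w ≠ v}, ‖injSum (Function.update (fun u => f (e (some u))) w
      fun x => f (e none) x * f (e (some w)) x)‖ ≤ ε * x ^ (r - 2) := by
    intro w
    -- Pulling out `ε` leaves a merged factor whose ℓ¹ norm is again at most 1.
    have hre : (fun x => f (e none) x * f (e (some w)) x) =
        fun x => (ε : ℂ) * ((ε : ℂ)⁻¹ * (f v x * f w x)) := by
      funext x
      have : (ε : ℂ) ≠ 0 := by exact_mod_cast hε.ne'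
      simp [e]
      field_simp
    rw [hre, injSum_update_smul, norm_mul, Complex.norm_real, Real.norm_of_nonneg hε.le]
    refine mul_le_mul_of_nonneg_left ?_ hε.le
    -- The merged factor at `w` need not sum to zero, so `w` is discarded.
    set D' : Finset {w // w ≠ v} := (D.subtype fun u => u ≠ v).erase w with hD'
    have hc0 : (D.subtype fun u => u ≠ v).card = r - 1 := by
      rw [Finset.card_subtype, Finset.filter_ne' D v, Finset.card_erase_of_mem hv, hD]
    have hc1 : D'.card ≤ r - 1 := hc0 ▸ Finset.card_le_card (Finset.erase_subset _ _)
    have hc2 : r - 2 ≤ D'.card := by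
      have := Finset.pred_card_le_card_erase (s := D.subtype fun u => u ≠ v) (a := w)
      rw [hc0] at this
      exact this
    refine le_trans (ih D'.card (by omega) {w // w ≠ v} _ D' ?_ rfl ?_ ?_ ?_)
      (pow_le_pow_of_le_one hx0 hm hc2)
    · exact (Fintype.card_subtype_le _).trans hV
    · intro u
      by_cases hu : u = w
      · subst hu
        rw [Function.update_self]
        calc ∑ x, ‖(ε : ℂ)⁻¹ * (f v x * f u x)‖ ≤ ∑ x, ‖f u x‖ := by
              refine Finset.sum_le_sum fun x _ => ?_
              rw [norm_mul, norm_inv, Complex.norm_real, Real.norm_of_nonneg hε.le, norm_mul,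
                ← mul_assoc]
              refine mul_le_of_le_one_left (norm_nonneg _) ?_
              rw [inv_mul_le_one₀ hε]
              exact hsup v hv x
          _ ≤ 1 := h1 _
      · rw [Function.update_of_ne hu]
        exact h1 _
    · intro u hu
      rw [Function.update_of_ne (Finset.ne_of_mem_erase hu)]
      have : (u : V) ∈ D := by simpa using (Finset.mem_of_mem_erase hu)
      simpa [e] using h0 u this
    · intro u hu
      rw [Function.update_of_ne (Finset.ne_of_mem_erase hu)]
      have : (u : V) ∈ D := by simpa using (Finset.mem_of_mem_erase hu)
      simpa [e] using hsup u this
  refine (norm_sum_le _ _).trans ((Finset.sum_le_sum fun w _ => key w).trans ?_)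
  rw [Finset.sum_const, Finset.card_univ, nsmul_eq_mul]
  have hcard : (Fintype.card {w // w ≠ v} : ℝ) ≤ m := by
    exact_mod_cast (Fintype.card_subtype_le _).trans hV
  refine (mul_le_mul_of_nonneg_right hcard (by positivity)).trans ?_
  -- For `r = 1` the exponent `r - 2` truncates to 0, and `ε ≤ √ε` is used instead.
  obtain rfl | hr2 : r = 1 ∨ 2 ≤ r := by omega
  · have : √ε ≤ 1 := by nlinarith
    simp only [Nat.reduceSub, pow_zero, mul_one, pow_one, hx]
    refine mul_le_mul_of_nonneg_left ?_ (by positivity)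
    nlinarith
  · obtain ⟨k, rfl⟩ := Nat.exists_eq_add_of_le hr2
    rw [Nat.add_sub_cancel_left, pow_add, ← mul_assoc]
    refine mul_le_mul_of_nonneg_right ?_ (by positivity)
    have : x ^ 2 = m * m * ε := by rw [hx, mul_pow, Real.sq_sqrt hε.le]; ring
    rw [this]
    refine mul_le_mul_of_nonneg_right ?_ hε.le
    nlinarith

/-- Entries are drawn one at a time: a new one avoids `k` earlier values with probability at least
`1 - kε`. -/
theorem one_sub_le_injSum {X : Type*} [Fintype X] [DecidableEq X] {ε : ℝ}
    (V : Type) [Fintype V] [DecidableEq V] (p : V → X → ℝ)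
    (h0 : ∀ v x, 0 ≤ p v x) (h1 : ∀ v, ∑ x, p v x = 1) (hε : ∀ v x, p v x ≤ ε) :
    1 - (Fintype.card V : ℝ) ^ 2 * ε ≤ injSum p := by
  suffices H : ∀ (k : ℕ) (V : Type) [Fintype V] [DecidableEq V] (p : V → X → ℝ),
      Fintype.card V = k → (∀ v x, 0 ≤ p v x) → (∀ v, ∑ x, p v x = 1) → (∀ v x, p v x ≤ ε) →
      1 - (k : ℝ) ^ 2 * ε ≤ injSum p from H _ V p rfl h0 h1 hε
  intro k
  induction k with
  | zero =>
    intro V _ _ p hV _ _ _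
    have := Fintype.card_eq_zero_iff.1 hV
    simp [injSum]
  | succ k ih =>
    intro V _ _ p hV h0 h1 hε
    obtain ⟨v⟩ : Nonempty V := Fintype.card_pos_iff.1 (by omega)
    let e : Option {w // w ≠ v} ≃ V := Equiv.optionSubtypeNe v
    have hVc : Fintype.card {w // w ≠ v} = k := by
      have := Fintype.card_congr e
      rw [Fintype.card_option] at this
      omega
    have hε0 : 0 ≤ ε := by
      by_contra hneg
      have hX : ∑ x, p v x ≤ 0 :=
        Finset.sum_nonpos fun x _ => (hε v x).trans (not_le.1 hneg).le
      rw [h1] at hX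
      linarith
    have ih' := ih {w // w ≠ v} (fun u => p u) hVc (fun _ => h0 _) (fun _ => h1 _) (fun _ => hε _)
    have hle := injSum_le_one (fun u : {w // w ≠ v} => p u) (fun _ => h0 _) (fun _ => (h1 _).le)
    rw [← injSum_congr_equiv e p, injSum_option]
    have step : (1 - k * ε) * injSum (fun u : {w // w ≠ v} => p u) ≤
        ∑ z : {w // w ≠ v} ↪ X, (∏ u, p (e (some u)) (z u)) *
          (∑ x, p (e none) x - ∑ u, p (e none) (z u)) := by
      unfold injSum
      rw [Finset.mul_sum]
      refine Finset.sum_le_sum fun z _ => ?_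
      rw [mul_comm, h1]
      refine mul_le_mul_of_nonneg_left ?_ (Finset.prod_nonneg fun u _ => h0 _ _)
      have : ∑ u, p (e none) (z u) ≤ ∑ _u : {w // w ≠ v}, ε := Finset.sum_le_sum fun u _ => hε _ _
      rw [Finset.sum_const, Finset.card_univ, hVc, nsmul_eq_mul] at this
      linarith
    refine le_trans ?_ step
    push_cast
    have hk : (0 : ℝ) ≤ k * ε := by positivity
    nlinarith [mul_le_mul_of_nonneg_left hle hk]

/-! ### Trace-norm duality -/

/-- The operator norm of `W` is at most one, as a bound on its sesquilinear form. -/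
def IsContraction {m : Type*} [Fintype m] (W : Matrix m m ℂ) : Prop :=
  ∀ (u v : m → ℂ) (a : ℝ), ∑ i, ‖u i‖ ^ 2 ≤ a → ∑ i, ‖v i‖ ^ 2 ≤ a →
    ‖star v ⬝ᵥ (W *ᵥ u)‖ ≤ a

-- Polar decomposition: the witness is `Aᴴ (A Aᴴ)^(-1/2)` with a pseudo-inverse square root.
open scoped MatrixOrder ComplexOrder in
theorem exists_isContraction_traceNorm {m : Type*} [Fintype m] [DecidableEq m]
    (A : Matrix m m ℂ) :
    ∃ W : Matrix m m ℂ, IsContraction W ∧ traceNorm A = (Matrix.trace (W * A)).re := by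
  set P : Matrix m m ℂ := A * Aᴴ with hP
  have hPsd : P.PosSemidef := Matrix.posSemidef_self_mul_conjTranspose A
  have hPsa : IsSelfAdjoint P := hPsd.isHermitian
  have hspec : ∀ x ∈ spectrum ℝ P, 0 ≤ x := fun x hx =>
    spectrum_nonneg_of_nonneg (Matrix.nonneg_iff_posSemidef.2 hPsd) hx
  have hfin : (spectrum ℝ P).Finite := Matrix.finite_real_spectrum
  have hc : ∀ f : ℝ → ℝ, ContinuousOn f (spectrum ℝ P) := fun f => hfin.continuousOn f
  -- Since `0⁻¹ = 0`, this inverts the root on the support of `P` only, and `Q * P * Q` is the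
  -- support projection.
  set Q : Matrix m m ℂ := cfc (fun x : ℝ => (√x)⁻¹) P with hQ
  have hQsa : Qᴴ = Q := (cfc_predicate (fun x : ℝ => (√x)⁻¹) P : IsSelfAdjoint _)
  have hQP : Q * P = cfc Real.sqrt P := by
    have : Q * P = cfc (fun x : ℝ => (√x)⁻¹) P * cfc (fun x : ℝ => x) P := by
      rw [cfc_id' ℝ P]
    rw [this, ← cfc_mul _ _ P (hc _) (hc _)]
    refine cfc_congr fun x hx => ?_
    have := hspec x hx
    rcases this.eq_or_lt with h | h
    · simp [← h]
    · have h' := Real.sqrt_pos.2 h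
      field_simp
      rw [Real.sq_sqrt this]
  have hQPQ : Q * P * Q = cfc (fun x : ℝ => √x * (√x)⁻¹) P := by
    rw [hQP, hQ, ← cfc_mul _ _ P (hc _) (hc _)]
  have hle : ((1 : Matrix m m ℂ) - Q * P * Q).PosSemidef := by
    rw [← Matrix.nonneg_iff_posSemidef, sub_nonneg, hQPQ]
    refine cfc_le_one _ _ fun x _ => ?_
    exact mul_inv_le_one
  have hW : ∀ u : m → ℂ, ∑ i, ‖((Aᴴ * Q) *ᵥ u) i‖ ^ 2 ≤ ∑ i, ‖u i‖ ^ 2 := by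
    intro u
    have hn : ∀ w : m → ℂ, star w ⬝ᵥ w = ((∑ i, ‖w i‖ ^ 2 : ℝ) : ℂ) := by
      intro w
      simp [dotProduct, ← Complex.conj_mul']
    have h := hle.dotProduct_mulVec_nonneg u
    have hcalc : star ((Aᴴ * Q) *ᵥ u) ⬝ᵥ ((Aᴴ * Q) *ᵥ u) = star u ⬝ᵥ ((Q * P * Q) *ᵥ u) := by
      rw [Matrix.star_mulVec, ← Matrix.dotProduct_mulVec, Matrix.mulVec_mulVec,
        Matrix.conjTranspose_mul, Matrix.conjTranspose_conjTranspose, hQsa, hP]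
      simp only [Matrix.mul_assoc]
    rw [Matrix.sub_mulVec, Matrix.one_mulVec, dotProduct_sub, ← hcalc, hn, hn,
      ← Complex.ofReal_sub, Complex.zero_le_real, sub_nonneg] at h
    exact h
  refine ⟨Aᴴ * Q, fun u v a hu hv => ?_, ?_⟩
  · set w := (Aᴴ * Q) *ᵥ u
    have hw := (hW u).trans hu
    calc ‖star v ⬝ᵥ w‖ ≤ ∑ i, ‖v i‖ * ‖w i‖ := by
          refine (norm_sum_le _ _).trans (le_of_eq ?_)
          simp
      _ ≤ ∑ i, (‖v i‖ ^ 2 + ‖w i‖ ^ 2) / 2 := by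
          refine Finset.sum_le_sum fun i _ => ?_
          nlinarith [sq_nonneg (‖v i‖ - ‖w i‖)]
      _ ≤ a := by
          rw [← Finset.sum_div, Finset.sum_add_distrib]
          linarith
  · rw [traceNorm, ← hP, ← hQP, Matrix.mul_assoc, Matrix.trace_mul_comm Aᴴ, Matrix.mul_assoc]

/-- The double sum is the form of `W` at the indicator vectors of the two images, each of squared
norm `card G`. -/
theorem IsContraction.norm_sum_sum_le {m G : Type*} [Fintype m] [DecidableEq m] [Fintype G]
    {W : Matrix m m ℂ} (hW : IsContraction W) {a b : G → m}
    (ha : Function.Injective a) (hb : Function.Injective b) :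
    ‖∑ g, ∑ h, W (b h) (a g)‖ ≤ Fintype.card G := by
  have aux : ∀ c : G → m, Function.Injective c →
      ∑ i, ‖(if i ∈ Finset.univ.image c then (1 : ℂ) else 0)‖ ^ 2 ≤ (Fintype.card G : ℝ) := by
    intro c hc
    have : ∀ i, ‖(if i ∈ Finset.univ.image c then (1 : ℂ) else 0)‖ ^ 2 =
        if i ∈ Finset.univ.image c then (1 : ℝ) else 0 := fun i => by split_ifs <;> simp
    simp only [this]
    rw [Finset.sum_ite_mem, Finset.univ_inter, Finset.sum_const, Finset.card_image_of_injective _ hc]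
    simp
  have h := hW _ _ _ (aux a ha) (aux b hb)
  convert h using 2
  rw [Finset.sum_comm]
  simp only [dotProduct, Matrix.mulVec, Pi.star_apply, apply_ite star, star_one, star_zero,
    ite_mul, one_mul, zero_mul, mul_ite, mul_one, mul_zero, Finset.sum_ite_mem, Finset.univ_inter]
  rw [Finset.sum_image hb.injOn]
  exact Finset.sum_congr rfl fun h _ => by rw [Finset.sum_image ha.injOn]

/-! ### Averages over random permutations and signs -/

section Averages

variable {V X : Type*} [Fintype V]

theorem exists_perm_comp_eq [Fintype X] [DecidableEq X] (z w : V ↪ X) : ∃ π : Equiv.Perm X, ∀ v, π (z v) = w v := by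
  let e : {x // x ∈ Set.range z} ≃ {x // x ∈ Set.range w} :=
    (Equiv.ofInjective z z.injective).symm.trans (Equiv.ofInjective w w.injective)
  refine ⟨e.extendSubtype, fun v => ?_⟩
  rw [Equiv.extendSubtype_apply_of_mem _ _ ⟨v, rfl⟩]
  have : (⟨z v, ⟨v, rfl⟩⟩ : {x // x ∈ Set.range z}) = Equiv.ofInjective z z.injective v := rfl
  simp only [e, Equiv.trans_apply]
  rw [this, Equiv.symm_apply_apply]
  rfl

/-- Permutations act transitively on embeddings, so the left side does not depend on `z` and may be
averaged over all of them. -/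
theorem expect_perm_eq [DecidableEq V] [Fintype X] [DecidableEq X] (F : (V → X) → ℂ) (z : V ↪ X) :
    𝔼 π : Equiv.Perm X, F (fun v => π.symm (z v)) =
      (((Fintype.card X).descFactorial (Fintype.card V) : ℕ) : ℂ)⁻¹ * ∑ w : V ↪ X, F w := by
  have h1 : ∀ w : V ↪ X, 𝔼 π : Equiv.Perm X, F (fun v => π.symm (w v)) =
      𝔼 π : Equiv.Perm X, F (fun v => π.symm (z v)) := by
    intro w
    obtain ⟨π₀, h⟩ := exists_perm_comp_eq z w
    refine Fintype.expect_equiv (Equiv.mulLeft π₀⁻¹) _ _ fun π => ?_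
    congr 1
    funext v
    rw [Equiv.symm_apply_eq, ← h, ← Equiv.eq_symm_apply]
    simp [← Equiv.Perm.inv_def, mul_inv_rev]
    exact (π₀.symm_apply_apply _).symm
  have h2 : ∑ w : V ↪ X, F w = ∑ w : V ↪ X, 𝔼 π : Equiv.Perm X, F (fun v => π.symm (w v)) := by
    rw [← Finset.expect_sum_comm, eq_comm]
    have : ∀ π : Equiv.Perm X, ∑ w : V ↪ X, F (fun v => π.symm (w v)) = ∑ w : V ↪ X, F w := by
      intro π
      refine Fintype.sum_equiv (Equiv.embeddingCongr (Equiv.refl V) π.symm) _ _ fun w => ?_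
      congr 1
    simp only [this]
    exact Fintype.expect_const _
  rw [h2, Finset.sum_congr rfl fun w _ => h1 w, Finset.sum_const, Finset.card_univ,
    Fintype.card_embedding_eq, nsmul_eq_mul, inv_mul_cancel_left₀]
  have : Fintype.card (V ↪ X) ≠ 0 := (Fintype.card_pos_iff.2 ⟨z⟩).ne'
  rw [Fintype.card_embedding_eq] at this
  exact_mod_cast this

/-- The phase picked up by the pair of tuples `z`, `z'` under a random sign function. -/
noncomputable def signProd (g : X → ℤˣ) (z z' : V → X) : ℂ :=
  (∏ v, ((g (z v) : ℤ) : ℂ)) * ∏ v, ((g (z' v) : ℤ) : ℂ)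

/-- Flipping `g` at the point `z v₀` preserves the uniform distribution and negates the product: `z`
visits that point once, `z'` never. -/
theorem expect_signProd_eq_zero [Fintype X] [DecidableEq X] {z z' : V → X} (hz : Function.Injective z) (v₀ : V)
    (h : ∀ v, z' v ≠ z v₀) : 𝔼 g : X → ℤˣ, signProd g z z' = 0 := by
  let k : X → ℤˣ := Pi.mulSingle (z v₀) (-1)
  have h1 : 𝔼 g : X → ℤˣ, signProd g z z' = 𝔼 g : X → ℤˣ, -signProd g z z' := by
    refine Fintype.expect_equiv (Equiv.mulRight k) _ _ fun g => ?_
    unfold signProd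
    have hk : ∏ v, ((k (z v) : ℤ) : ℂ) = -1 := by
      rw [Finset.prod_eq_single v₀]
      · simp [k]
      · intro v _ hv
        simp [k, hz.ne hv]
      · simp
    have hk' : ∏ v, ((k (z' v) : ℤ) : ℂ) = 1 :=
      Finset.prod_eq_one fun v _ => by simp [k, h v]
    simp only [Equiv.coe_mulRight, Pi.mul_apply, Units.val_mul, Int.cast_mul,
      Finset.prod_mul_distrib, hk, hk']
    ring
  rw [Finset.expect_neg_distrib] at h1
  exact self_eq_neg.1 h1

theorem signProd_comm (g : X → ℤˣ) (z z' : V → X) : signProd g z z' = signProd g z' z :=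
  mul_comm _ _

theorem signProd_comp_perm (g : X → ℤˣ) (z : V → X) (τ : Equiv.Perm V) :
    signProd g z (z ∘ τ) = 1 := by
  unfold signProd
  have : ∏ v, ((g ((z ∘ τ) v) : ℤ) : ℂ) = ∏ v, ((g (z v) : ℤ) : ℂ) :=
    Fintype.prod_equiv τ _ _ fun v => rfl
  rw [this, ← Finset.prod_mul_distrib]
  refine Finset.prod_eq_one fun v _ => ?_
  rcases Int.units_eq_one_or (g (z v)) with h | h <;> simp [h]

theorem exists_perm_of_range_subset {z z' : V → X} (hz : Function.Injective z)
    (h : ∀ v, ∃ w, z' w = z v) : ∃ τ : Equiv.Perm V, z' = z ∘ τ := by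
  choose τ₀ hτ using h
  have hinj : Function.Injective τ₀ := fun a b hab => hz (by rw [← hτ, ← hτ, hab])
  let τ := Equiv.ofBijective τ₀ (Finite.injective_iff_bijective.1 hinj)
  refine ⟨τ.symm, funext fun v => ?_⟩
  have := hτ (τ.symm v)
  rw [Function.comp_apply, ← this]
  congr 1
  exact (τ.apply_symm_apply v).symm

theorem expect_signProd_of_injective [Fintype X] [DecidableEq X] {z z' : V → X}
    (hz : Function.Injective z)
    (h : ¬∃ τ : Equiv.Perm V, z' = z ∘ τ) : 𝔼 g : X → ℤˣ, signProd g z z' = 0 := by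
  by_contra hne
  refine h (exists_perm_of_range_subset hz fun v => ?_)
  by_contra hv
  push Not at hv
  exact hne (expect_signProd_eq_zero hz v hv)

end Averages

/-! ### Matrix entries of the averaged state -/

/-- The amplitude of the tuple `z` in `⨂_j |α_j⟩^{⊗ t}`. -/
noncomputable def amplitude {n s t : ℕ} (α : Fin s → EuclideanSpace ℂ (BitString n))
    (z : Tuple n s t) : ℂ :=
  ∏ v : BlockIndex s t, α v.1 (z v)

section OutputState

variable {n s t : ℕ}

theorem matrix_expect_apply {ι m : Type*} [Fintype ι] (M : ι → Matrix m m ℂ) (i j : m) :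
    (𝔼 k, M k) i j = 𝔼 k, M k i j := by
  rw [Finset.expect, Finset.expect, Matrix.smul_apply, Matrix.sum_apply]

theorem tensorOp_mul (A B : BlockIndex s t → Matrix (BitString n) (BitString n) ℂ) :
    tensorOp A * tensorOp B = tensorOp fun v => A v * B v := by
  ext z z'
  simp only [tensorOp, Matrix.mul_apply, Matrix.of_apply, ← Finset.prod_mul_distrib]
  rw [Fintype.prod_sum]

theorem conjugated_ketBra_apply (g : BitString n → ℤˣ) (π : Equiv.Perm (BitString n))
    (α : EuclideanSpace ℂ (BitString n)) (y y' : BitString n) :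
    (permOp π * phaseOp g * ketBra α * ((phaseOp g)ᴴ * (permOp π)ᴴ)) y y' =
      ((g (π.symm y) : ℤ) : ℂ) * ((g (π.symm y') : ℤ) : ℂ) *
        (α (π.symm y) * star (α (π.symm y'))) := by
  have h : ∀ y x, (permOp π * phaseOp g) y x =
      if x = π.symm y then ((g x : ℤ) : ℂ) else 0 := by
    intro y x
    rw [phaseOp, Matrix.mul_diagonal, permOp, Matrix.of_apply]
    simp only [Equiv.eq_symm_apply, eq_comm (a := y), ite_mul, one_mul, zero_mul]
  rw [← Matrix.conjTranspose_mul, Matrix.mul_apply]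
  simp only [Matrix.mul_apply (M := permOp π * phaseOp g), Matrix.conjTranspose_apply, h, ite_mul,
    zero_mul, Finset.sum_ite_eq', Finset.mem_univ, if_true, apply_ite star, star_zero, mul_ite,
    mul_zero, ketBra, Matrix.of_apply]
  simp
  ring

theorem outputState_apply (α : Fin s → EuclideanSpace ℂ (BitString n)) (z z' : Tuple n s t) :
    outputState t α z z' = 𝔼 g : BitString n → ℤˣ, 𝔼 π : Equiv.Perm (BitString n),
      signProd g (π.symm ∘ z) (π.symm ∘ z') *
        (amplitude α (π.symm ∘ z) * star (amplitude α (π.symm ∘ z'))) := by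
  rw [outputState, matrix_expect_apply]
  refine Finset.expect_congr rfl fun g _ => ?_
  rw [matrix_expect_apply]
  refine Finset.expect_congr rfl fun π _ => ?_
  rw [inputState, tensorOp_mul, tensorOp_mul]
  change ∏ v, _ = _
  simp only [conjugated_ketBra_apply, signProd, amplitude, Finset.prod_mul_distrib,
    Function.comp_apply, star_prod]

theorem outputState_apply_eq_zero (α : Fin s → EuclideanSpace ℂ (BitString n))
    {z z' : Tuple n s t} (hz : Function.Injective z)
    (h : ¬∃ τ : Equiv.Perm (BlockIndex s t), z' = z ∘ τ) :
    outputState t α z z' = 0 ∧ outputState t α z' z = 0 := by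
  have key : ∀ π : Equiv.Perm (BitString n),
      𝔼 g : BitString n → ℤˣ, signProd g (π.symm ∘ z) (π.symm ∘ z') = 0 := by
    intro π
    refine expect_signProd_of_injective (π.symm.injective.comp hz) ?_
    rintro ⟨τ, hτ⟩
    exact h ⟨τ, π.symm.injective.comp_left hτ⟩
  constructor
  · rw [outputState_apply, Finset.expect_comm]
    refine Finset.expect_eq_zero fun π _ => ?_
    rw [← Finset.expect_mul, key, zero_mul]
  · rw [outputState_apply, Finset.expect_comm]
    refine Finset.expect_eq_zero fun π _ => ?_
    simp only [signProd_comm _ _ (π.symm ∘ z)]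
    rw [← Finset.expect_mul, key, zero_mul]

/-- The overlap `∑_z Φ(z) Φ(z')^*`, `z'` being `z` recoloured by `f`, over distinct tuples `z`. -/
noncomputable def overlap (α : Fin s → EuclideanSpace ℂ (BitString n))
    (f : BlockIndex s t → Fin s) : ℂ :=
  injSum fun v x => α v.1 x * star (α (f v) x)

/-- The signs square to 1, and averaging over `π` replaces `z` by a uniform distinct tuple. Only the
block of `τ.symm v` matters because all copies in a block carry the same vector. -/
theorem outputState_apply_comp_perm (α : Fin s → EuclideanSpace ℂ (BitString n))
    (z : BlockIndex s t ↪ BitString n) (τ : Equiv.Perm (BlockIndex s t)) :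
    outputState t α z (z ∘ τ) = (((2 ^ n).descFactorial (s * t) : ℕ) : ℂ)⁻¹ *
      overlap α fun v => (τ.symm v).1 := by
  rw [outputState_apply]
  have : ∀ (g : BitString n → ℤˣ) (π : Equiv.Perm (BitString n)),
      signProd g (π.symm ∘ z) (π.symm ∘ (z ∘ τ)) = 1 := fun g π =>
    signProd_comp_perm g (π.symm ∘ z) τ
  simp only [this, one_mul]
  rw [Fintype.expect_const]
  have h := expect_perm_eq (fun w : Tuple n s t => amplitude α w * star (amplitude α (w ∘ τ))) z
  have hc : Fintype.card (BitString n) = 2 ^ n := by simp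
  have hv : Fintype.card (BlockIndex s t) = s * t := by simp
  rw [hc, hv] at h
  refine h.trans ?_
  congr 1
  refine Finset.sum_congr rfl fun w _ => ?_
  rw [Finset.prod_mul_distrib, amplitude, amplitude, star_prod]
  congr 1
  refine Fintype.prod_equiv τ _ _ fun v => ?_
  simp

end OutputState

/-! ### Decomposition of the trace by colourings -/

theorem norm_expect_le_of_forall {ι : Type*} [Fintype ι] [Nonempty ι] (f : ι → ℂ) {a : ℝ}
    (h : ∀ i, ‖f i‖ ≤ a) : ‖𝔼 i, f i‖ ≤ a := by
  rw [Fintype.expect_eq_sum_div_card, norm_div, Complex.norm_natCast,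
    div_le_iff₀ (by exact_mod_cast Fintype.card_pos)]
  refine (norm_sum_le _ _).trans ((Finset.sum_le_sum fun i _ => h i).trans (le_of_eq ?_))
  simp [mul_comm]

open Classical in
theorem sum_ite_injective_eq_sum_embedding {V X M : Type*} [Fintype V] [DecidableEq V] [Fintype X]
    [DecidableEq X] [AddCommMonoid M] (G : (V → X) → M) :
    ∑ z, (if Function.Injective z then G z else 0) = ∑ z : V ↪ X, G z := by
  rw [← Finset.sum_filter]
  symm
  refine Finset.sum_bij (fun z _ => (z : V → X)) (fun z _ => by simpa using z.injective)
    (fun _ _ _ _ h => DFunLike.coe_injective h)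
    (fun z hz => ⟨⟨z, by simpa using hz⟩, Finset.mem_univ _, rfl⟩) fun _ _ => rfl

section Decomposition

variable {n s t : ℕ}

/-- Restricted to `P`, the state is an average of projectors `|u⟩⟨u|`; invariance of `P` under
relabelling gives every `u` the same norm. -/
theorem norm_sum_outputState_le {W : RegisterOp n s t} (hW : IsContraction W)
    (α : Fin s → EuclideanSpace ℂ (BitString n)) (P : Tuple n s t → Prop) [DecidablePred P]
    (hP : ∀ (π : Equiv.Perm (BitString n)) (z : Tuple n s t), P (π ∘ z) ↔ P z) :
    ‖∑ z, ∑ z', (if P z then (if P z' then W z' z * outputState t α z z' else 0) else 0)‖ ≤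
      ∑ z, if P z then ‖amplitude α z‖ ^ 2 else 0 := by
  let u : (BitString n → ℤˣ) → Equiv.Perm (BitString n) → Tuple n s t → ℂ := fun g π z =>
    if P z then (∏ v, ((g (π.symm (z v)) : ℤ) : ℂ)) * amplitude α (π.symm ∘ z) else 0
  have hu : ∀ g π, ∑ z, ‖u g π z‖ ^ 2 ≤ ∑ z, if P z then ‖amplitude α z‖ ^ 2 else 0 := by
    intro g π
    refine le_of_eq (Fintype.sum_equiv (Equiv.arrowCongr (Equiv.refl _) π.symm) _ _ fun z => ?_)
    have hz : Equiv.arrowCongr (Equiv.refl (BlockIndex s t)) π.symm z = π.symm ∘ z := rfl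
    rw [hz]
    simp only [hP π.symm z, u]
    have h1 : ∀ v, ‖((g (π.symm (z v)) : ℤ) : ℂ)‖ = 1 := fun v => by
      rcases Int.units_eq_one_or (g (π.symm (z v))) with h | h <;> simp [h]
    split_ifs
    · rw [norm_mul, norm_prod, Finset.prod_eq_one fun v _ => h1 v, one_mul]
    · simp
  have key : ∑ z, ∑ z', (if P z then (if P z' then W z' z * outputState t α z z' else 0) else 0) =
      𝔼 g, 𝔼 π, star (u g π) ⬝ᵥ (W *ᵥ u g π) := by
    have h1 : ∀ z z', (if P z then (if P z' then W z' z * outputState t α z z' else 0) else 0) =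
        𝔼 g, 𝔼 π, star (u g π z') * (W z' z * u g π z) := by
      intro z z'
      by_cases hz : P z
      · by_cases hz' : P z'
        · rw [if_pos hz, if_pos hz', outputState_apply, Finset.mul_expect]
          refine Finset.expect_congr rfl fun g _ => ?_
          rw [Finset.mul_expect]
          refine Finset.expect_congr rfl fun π _ => ?_
          simp only [u, if_pos hz, if_pos hz', signProd, star_mul', star_prod, Function.comp_apply]
          have : ∀ v, star (((g (π.symm (z' v)) : ℤ) : ℂ)) = ((g (π.symm (z' v)) : ℤ) : ℂ) :=
            fun v => by simp
          simp only [this]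
          ring
        · simp [u, hz']
      · simp [u, hz]
    simp only [h1, Finset.expect_sum_comm, dotProduct, Matrix.mulVec, Finset.mul_sum,
      Pi.star_apply]
    rw [Finset.sum_comm]
  rw [key]
  exact norm_expect_le_of_forall _ fun g => norm_expect_le_of_forall _ fun π =>
    hW _ _ _ (hu g π) (hu g π)

/-- `tr (W K_f)` for the operator `K_f` that averages `|z⟩⟨z ∘ τ|` over all tuples `z` of distinct
strings, summed over the permutations `τ` that recolour the blocks by `f`. -/
noncomputable def colourTerm (W : RegisterOp n s t) (f : BlockIndex s t → Fin s) : ℂ :=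
  (((2 ^ n).descFactorial (s * t) : ℕ) : ℂ)⁻¹ * ∑ z : BlockIndex s t ↪ BitString n,
    ∑ τ : Equiv.Perm (BlockIndex s t) with (fun v => (τ.symm v).1) = f, W (z ∘ τ) z

open Classical in
theorem trace_mul_outputState (W : RegisterOp n s t)
    (α : Fin s → EuclideanSpace ℂ (BitString n)) :
    Matrix.trace (W * outputState t α) = ∑ f, overlap α f * colourTerm W f +
      ∑ z, ∑ z', (if ¬Function.Injective z then
        (if ¬Function.Injective z' then W z' z * outputState t α z z' else 0) else 0) := by
  have h1 : Matrix.trace (W * outputState t α) = ∑ z, ∑ z', W z' z * outputState t α z z' := by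
    simp only [Matrix.trace, Matrix.diag, Matrix.mul_apply]
    exact Finset.sum_comm
  have h2 : ∀ z : BlockIndex s t ↪ BitString n, ∑ z', W z' z * outputState t α z z' =
      ∑ τ : Equiv.Perm (BlockIndex s t), W (z ∘ τ) z * outputState t α z (z ∘ τ) := by
    intro z
    have hinj : Function.Injective fun τ : Equiv.Perm (BlockIndex s t) => (z ∘ τ : Tuple n s t) :=
      fun τ τ' h => Equiv.ext fun v => z.injective (congrFun h v)
    rw [← Finset.sum_image (f := fun z' => W z' z * outputState t α z z') hinj.injOn]
    symm
    refine Finset.sum_subset (Finset.subset_univ _) fun z' _ hz' => ?_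
    rw [(outputState_apply_eq_zero α z.injective ?_).1, mul_zero]
    rintro ⟨τ, rfl⟩
    exact hz' (Finset.mem_image_of_mem _ (Finset.mem_univ τ))
  have h3 : ∀ z : Tuple n s t, ¬Function.Injective z → ∀ z', Function.Injective z' →
      outputState t α z z' = 0 := by
    intro z hz z' hz'
    refine (outputState_apply_eq_zero α hz' ?_).2
    rintro ⟨τ, rfl⟩
    exact hz (hz'.comp τ.injective)
  have h4 : ∀ z : Tuple n s t, ∑ z', W z' z * outputState t α z z' =
      (if Function.Injective z then ∑ z', W z' z * outputState t α z z' else 0) +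
      ∑ z', (if ¬Function.Injective z then
        (if ¬Function.Injective z' then W z' z * outputState t α z z' else 0) else 0) := by
    intro z
    by_cases hz : Function.Injective z
    · simp [hz]
    · rw [if_neg hz, zero_add]
      refine Finset.sum_congr rfl fun z' _ => ?_
      rw [if_pos hz]
      by_cases hz' : Function.Injective z'
      · rw [if_neg (not_not.2 hz'), h3 z hz z' hz', mul_zero]
      · rw [if_pos hz']
  rw [h1, Finset.sum_congr rfl fun z _ => h4 z, Finset.sum_add_distrib,
    sum_ite_injective_eq_sum_embedding fun z => ∑ z', W z' z * outputState t α z z']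
  congr 1
  simp only [h2, outputState_apply_comp_perm]
  rw [Finset.sum_comm]
  rw [← Finset.sum_fiberwise Finset.univ
    fun τ : Equiv.Perm (BlockIndex s t) => fun v => (τ.symm v).1]
  refine Finset.sum_congr rfl fun f _ => ?_
  rw [colourTerm, Finset.sum_comm (s := Finset.univ (α := BlockIndex s t ↪ BitString n))]
  simp only [Finset.mul_sum]
  refine Finset.sum_congr rfl fun τ hτ => Finset.sum_congr rfl fun z _ => ?_
  rw [← (Finset.mem_filter.1 hτ).2]
  ring

theorem blockPerm_injective : Function.Injective (blockPerm (s := s) (t := t)) := by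
  intro σ σ' h
  funext j
  ext i
  have := congrArg Prod.snd (DFunLike.congr_fun h (j, i))
  simpa [blockPerm] using congrArg Fin.val this

theorem exists_blockPerm_of_fst_eq (τ : Equiv.Perm (BlockIndex s t)) (h : ∀ v, (τ v).1 = v.1) :
    ∃ σ, blockPerm σ = τ := by
  have hinj : ∀ j, Function.Injective fun i => (τ (j, i)).2 := by
    intro j i i' hi
    have : τ (j, i) = τ (j, i') := Prod.ext ((h (j, i)).trans (h (j, i')).symm) hi
    simpa using τ.injective this
  refine ⟨fun j => Equiv.ofBijective _ (Finite.injective_iff_bijective.1 (hinj j)), ?_⟩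
  ext v : 1
  exact Prod.ext (h v).symm rfl

/-- Permutations inducing the same colouring form a left coset of the block permutations. -/
theorem sum_colour_eq_sum_blockPerm {M : Type*} [AddCommMonoid M]
    (τ₀ : Equiv.Perm (BlockIndex s t)) (F : Equiv.Perm (BlockIndex s t) → M) :
    ∑ τ : Equiv.Perm (BlockIndex s t) with (fun v => (τ.symm v).1) = fun v => (τ₀.symm v).1, F τ =
      ∑ σ, F (τ₀ * blockPerm σ) := by
  symm
  refine Finset.sum_bij (fun σ _ => τ₀ * blockPerm σ) (fun σ _ => ?_)
    (fun σ _ σ' _ h => blockPerm_injective (mul_left_cancel h)) (fun τ hτ => ?_) fun _ _ => rfl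
  · simp only [Finset.mem_filter, Finset.mem_univ, true_and]
    funext v
    have : (τ₀ * blockPerm σ).symm v = (blockPerm σ).symm (τ₀.symm v) := rfl
    rw [this]
    simp [blockPerm]
  · have h := (Finset.mem_filter.1 hτ).2
    obtain ⟨σ, hσ⟩ := exists_blockPerm_of_fst_eq (τ₀⁻¹ * τ) fun v => by
      have := congrFun h (τ v)
      simp only [Equiv.symm_apply_apply] at this
      exact this.symm
    exact ⟨σ, Finset.mem_univ _, by rw [hσ, mul_inv_cancel_left]⟩

theorem trace_mul_uniState (W : RegisterOp n s t) :
    Matrix.trace (W * uniState n s t) = colourTerm W Prod.fst := by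
  have h := fun z : BlockIndex s t ↪ BitString n =>
    sum_colour_eq_sum_blockPerm 1 fun τ : Equiv.Perm (BlockIndex s t) => W (z ∘ τ) z
  have h1 : (fun v => ((1 : Equiv.Perm (BlockIndex s t)).symm v).1) = Prod.fst := rfl
  rw [h1] at h
  simp only [colourTerm, h, one_mul, uniState, Matrix.mul_smul, Matrix.trace_smul, Matrix.mul_sum,
    Matrix.trace_sum, Matrix.trace_mul_single, MulOpposite.op_one, one_smul, smul_eq_mul]
  rfl

/-- Bounding the entries of `W` separately would lose a factor `card G`, `G = S_t^s`. Instead,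
reindexing `z` introduces a second free `σ : G` without changing the sum. For each `z` the double
sum over `G × G` is at most `card G`, which cancels the `card G` copies of `S`. -/
theorem norm_colourTerm_le_one {W : RegisterOp n s t} (hW : IsContraction W)
    (f : BlockIndex s t → Fin s) : ‖colourTerm W f‖ ≤ 1 := by
  by_cases hf : ∃ τ₀ : Equiv.Perm (BlockIndex s t), (fun v => (τ₀.symm v).1) = f
  swap
  · have : Finset.univ.filter
        (fun τ : Equiv.Perm (BlockIndex s t) => (fun v => (τ.symm v).1) = f) = ∅ :=
      Finset.filter_eq_empty_iff.2 fun τ _ h => hf ⟨τ, h⟩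
    simp [colourTerm, this]
  obtain ⟨τ₀, rfl⟩ := hf
  simp only [colourTerm, sum_colour_eq_sum_blockPerm τ₀]
  set G := Fin s → Equiv.Perm (Fin t)
  set S := ∑ z : BlockIndex s t ↪ BitString n, ∑ σ : G, W (z ∘ ⇑(τ₀ * blockPerm σ)) z with hS
  have hmul : ∀ σ σ' : G, blockPerm (σ⁻¹ * σ') = (blockPerm σ)⁻¹ * blockPerm σ' := by
    intro σ σ'
    rfl
  have hshift : ∀ σ : G, ∑ z : BlockIndex s t ↪ BitString n, ∑ σ' : G,
      W (z ∘ blockPerm σ') (z ∘ ⇑(blockPerm σ * τ₀⁻¹)) = S := by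
    intro σ
    rw [hS]
    refine Fintype.sum_equiv
      (Equiv.embeddingCongr (blockPerm σ * τ₀⁻¹)⁻¹ (Equiv.refl _)) _ _ fun z => ?_
    refine Fintype.sum_equiv (Equiv.mulLeft σ⁻¹) _ _ fun σ' => ?_
    rw [Equiv.coe_mulLeft, hmul]
    congr 1
    funext v
    change z (blockPerm σ' v) = z ((blockPerm σ * τ₀⁻¹) ((τ₀ * ((blockPerm σ)⁻¹ * blockPerm σ')) v))
    rw [← Equiv.Perm.mul_apply]
    simp [mul_assoc]
  have hcardS : (Fintype.card G : ℝ) * ‖S‖ ≤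
      (Fintype.card G : ℝ) * Fintype.card (BlockIndex s t ↪ BitString n) := by
    have h1 : (Fintype.card G : ℂ) * S = ∑ z : BlockIndex s t ↪ BitString n, ∑ σ : G, ∑ σ' : G,
        W (z ∘ blockPerm σ') (z ∘ ⇑(blockPerm σ * τ₀⁻¹)) := by
      rw [Finset.sum_comm, Finset.sum_congr rfl fun σ _ => hshift σ]
      simp
    have h2 := congrArg norm h1
    rw [norm_mul, Complex.norm_natCast] at h2
    rw [h2]
    have h3 : ∀ z : BlockIndex s t ↪ BitString n, ‖∑ σ : G, ∑ σ' : G,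
        W (z ∘ blockPerm σ') (z ∘ ⇑(blockPerm σ * τ₀⁻¹))‖ ≤ Fintype.card G := by
      intro z
      let a : G → Tuple n s t := fun σ => z ∘ ⇑(blockPerm σ * τ₀⁻¹)
      let b : G → Tuple n s t := fun σ => z ∘ ⇑(blockPerm σ)
      have ha : Function.Injective a := fun σ σ' h => blockPerm_injective
        (mul_right_cancel (Equiv.ext fun v => z.injective (congrFun h v)))
      have hb : Function.Injective b := fun σ σ' h => blockPerm_injective
        (Equiv.ext fun v => z.injective (congrFun h v))
      exact hW.norm_sum_sum_le ha hb
    refine (norm_sum_le _ _).trans ((Finset.sum_le_sum fun z _ => h3 z).trans (le_of_eq ?_))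
    rw [Finset.sum_const, Finset.card_univ, nsmul_eq_mul, mul_comm]
  have hG : (0 : ℝ) < Fintype.card G := by exact_mod_cast Fintype.card_pos
  have hS' := le_of_mul_le_mul_left hcardS hG
  rw [Fintype.card_embedding_eq] at hS'
  have hc : Fintype.card (BitString n) = 2 ^ n := by simp
  have hv : Fintype.card (BlockIndex s t) = s * t := by simp
  rw [hc, hv] at hS'
  rw [norm_mul, norm_inv, Complex.norm_natCast]
  -- This also covers `st > N`, where the descending factorial and its inverse are 0.
  exact inv_mul_le_one_of_le₀ hS' (Nat.cast_nonneg _)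

end Decomposition

/-! ### Quantitative estimates -/

section Estimates

variable {n s t : ℕ}

theorem sum_norm_sq_eq_one {α : Fin s → EuclideanSpace ℂ (BitString n)} (hα : Orthonormal ℂ α)
    (j : Fin s) : ∑ x, ‖α j x‖ ^ 2 = 1 := by
  rw [← EuclideanSpace.norm_sq_eq, hα.1 j, one_pow]

theorem sum_norm_amplitude_sq {α : Fin s → EuclideanSpace ℂ (BitString n)}
    (hα : Orthonormal ℂ α) : ∑ z : Tuple n s t, ‖amplitude α z‖ ^ 2 = 1 := by
  simp only [amplitude, norm_prod, ← Finset.prod_pow]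
  rw [← Fintype.prod_sum fun (v : BlockIndex s t) x => ‖α v.1 x‖ ^ 2]
  exact Finset.prod_eq_one fun v _ => sum_norm_sq_eq_one hα v.1

/-- The probability that measuring `⨂_j |α_j⟩^{⊗ t}` yields pairwise distinct strings. -/
noncomputable def distinctWeight (t : ℕ) (α : Fin s → EuclideanSpace ℂ (BitString n)) : ℝ :=
  injSum fun (v : BlockIndex s t) x => ‖α v.1 x‖ ^ 2

open Classical in
theorem sum_norm_amplitude_sq_not_injective {α : Fin s → EuclideanSpace ℂ (BitString n)}
    (hα : Orthonormal ℂ α) :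
    ∑ z : Tuple n s t, (if ¬Function.Injective z then ‖amplitude α z‖ ^ 2 else 0) =
      1 - distinctWeight t α := by
  rw [eq_sub_iff_add_eq, ← sum_norm_amplitude_sq hα (t := t)]
  have : distinctWeight t α =
      ∑ z : Tuple n s t, if Function.Injective z then ‖amplitude α z‖ ^ 2 else 0 := by
    rw [sum_ite_injective_eq_sum_embedding fun z : Tuple n s t => ‖amplitude α z‖ ^ 2]
    simp only [distinctWeight, injSum, amplitude, norm_prod, Finset.prod_pow]
  rw [this, ← Finset.sum_add_distrib]
  refine Finset.sum_congr rfl fun z _ => ?_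
  by_cases hz : Function.Injective z <;> simp [hz]

theorem distinctWeight_le_one {α : Fin s → EuclideanSpace ℂ (BitString n)}
    (hα : Orthonormal ℂ α) : distinctWeight t α ≤ 1 :=
  injSum_le_one _ (fun _ _ => sq_nonneg _) fun v => (sum_norm_sq_eq_one hα v.1).le

theorem one_sub_le_distinctWeight {ε : ℝ} {α : Fin s → EuclideanSpace ℂ (BitString n)}
    (hα : Orthonormal ℂ α) (hε : ∀ j, IsFlat ε (α j)) :
    1 - ((s : ℝ) * t) ^ 2 * ε ≤ distinctWeight t α := by
  have := one_sub_le_injSum (BlockIndex s t) (fun v x => ‖α v.1 x‖ ^ 2)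
    (fun _ _ => sq_nonneg _) (fun v => sum_norm_sq_eq_one hα v.1) fun v x => hε v.1 x
  simpa [distinctWeight] using this

theorem overlap_fst (α : Fin s → EuclideanSpace ℂ (BitString n)) :
    overlap α (Prod.fst : BlockIndex s t → Fin s) = distinctWeight t α := by
  simp only [overlap, distinctWeight, injSum, Complex.ofReal_sum, Complex.ofReal_prod,
    Complex.ofReal_pow]
  refine Finset.sum_congr rfl fun z _ => Finset.prod_congr rfl fun v _ => ?_
  exact Complex.mul_conj' _

/-- Such an `f` rearranges the block labels and keeps their sum, which a single change would alter.
-/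
theorem two_le_card_recoloured {f : BlockIndex s t → Fin s} (hf : f ≠ Prod.fst)
    (τ : Equiv.Perm (BlockIndex s t)) (h : (fun v => (τ.symm v).1) = f) :
    2 ≤ (Finset.univ.filter fun v => f v ≠ v.1).card := by
  have hsum : ∑ v, (((f v : ℕ) : ℤ) - ((v.1 : ℕ) : ℤ)) = 0 := by
    rw [Finset.sum_sub_distrib, sub_eq_zero, ← h]
    exact Fintype.sum_equiv τ.symm _ _ fun v => rfl
  have hne : (Finset.univ.filter fun v => f v ≠ v.1).card ≠ 0 := by
    intro h0
    rw [Finset.card_eq_zero, Finset.filter_eq_empty_iff] at h0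
    exact hf (funext fun v => not_not.1 (h0 (Finset.mem_univ v)))
  have hne1 : (Finset.univ.filter fun v => f v ≠ v.1).card ≠ 1 := by
    intro h1
    obtain ⟨v, hv⟩ := Finset.card_eq_one.1 h1
    have hmem : ∀ w, f w ≠ w.1 ↔ w = v := fun w => by
      simpa using Finset.ext_iff.1 hv w
    rw [Finset.sum_eq_single v] at hsum
    · refine (hmem v).2 rfl (Fin.ext ?_)
      omega
    · intro w _ hw
      have : f w = w.1 := not_not.1 fun h' => hw ((hmem w).1 h')
      rw [this, sub_self]
    · simp
  omega

theorem norm_mul_star_le (a b : ℂ) : ‖a * star b‖ ≤ (‖a‖ ^ 2 + ‖b‖ ^ 2) / 2 := by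
  rw [norm_mul, norm_star]
  nlinarith [sq_nonneg (‖a‖ - ‖b‖)]

theorem norm_overlap_le {ε : ℝ} (hε0 : 0 < ε) {α : Fin s → EuclideanSpace ℂ (BitString n)}
    (hα : Orthonormal ℂ α) (hε : ∀ j, IsFlat ε (α j)) (hst : (s : ℝ) * t * √ε ≤ 1)
    (f : BlockIndex s t → Fin s) :
    ‖overlap α f‖ ≤ ((s : ℝ) * t * √ε) ^ (Finset.univ.filter fun v => f v ≠ v.1).card := by
  have h := norm_injSum_le_pow hε0 (s * t) (by push_cast; exact hst) _ (BlockIndex s t)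
    (fun v x => α v.1 x * star (α (f v) x)) (Finset.univ.filter fun v => f v ≠ v.1) (by simp) rfl
    ?_ ?_ ?_
  · push_cast at h
    exact h
  · intro v
    refine (Finset.sum_le_sum fun x _ => norm_mul_star_le _ _).trans ?_
    rw [← Finset.sum_div, Finset.sum_add_distrib, sum_norm_sq_eq_one hα, sum_norm_sq_eq_one hα]
    norm_num
  · intro v hv
    have := hα.2 (Finset.mem_filter.1 hv).2
    simpa [PiLp.inner_apply] using this
  · intro v _ x
    refine (norm_mul_star_le _ _).trans ?_
    linarith [hε v.1 x, hε (f v) x]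

/-- The sum factorises over the `st` positions, each contributing at most `1 + 1/(st) ≤ exp
(1/(st))`; the product is at most `e`. -/
theorem sum_pow_card_recoloured_le (hs : 0 < s) (ht : 0 < t) :
    ∑ f : BlockIndex s t → Fin s,
      (((s : ℝ) * (s * t))⁻¹) ^ (Finset.univ.filter fun v => f v ≠ v.1).card ≤ 3 := by
  have hs' : (0 : ℝ) < s := by exact_mod_cast hs
  have ht' : (0 : ℝ) < t := by exact_mod_cast ht
  set l : ℝ := ((s : ℝ) * (s * t))⁻¹ with hl
  have hl0 : 0 ≤ l := by positivity
  have h1 : ∀ f : BlockIndex s t → Fin s, l ^ (Finset.univ.filter fun v => f v ≠ v.1).card =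
      ∏ v, if f v ≠ v.1 then l else 1 := by
    intro f
    rw [Finset.prod_ite, Finset.prod_const, Finset.prod_const_one, mul_one]
  have h2 : ∀ v : BlockIndex s t, ∑ a : Fin s, (if a ≠ v.1 then l else 1) ≤
      Real.exp (((s : ℝ) * t)⁻¹) := by
    intro v
    calc ∑ a : Fin s, (if a ≠ v.1 then l else 1) ≤ ∑ a : Fin s, (l + if a = v.1 then 1 else 0) :=
          Finset.sum_le_sum fun a _ => by by_cases h : a = v.1 <;> simp [h, hl0]
      _ = ((s : ℝ) * t)⁻¹ + 1 := by
          rw [Finset.sum_add_distrib]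
          simp [hl]
          field_simp
      _ ≤ _ := Real.add_one_le_exp _
  simp only [h1]
  rw [← Fintype.prod_sum fun (v : BlockIndex s t) (a : Fin s) => if a ≠ v.1 then l else 1]
  calc ∏ v : BlockIndex s t, ∑ a : Fin s, (if a ≠ v.1 then l else 1)
      ≤ ∏ _v : BlockIndex s t, Real.exp (((s : ℝ) * t)⁻¹) :=
        Finset.prod_le_prod (fun v _ => Finset.sum_nonneg fun a _ => by split_ifs <;> positivity)
          fun v _ => h2 v
    _ = Real.exp 1 := by
        rw [Finset.prod_const, ← Real.exp_nat_mul]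
        congr 1
        simp only [Finset.card_univ, Fintype.card_prod, Fintype.card_fin, Nat.cast_mul]
        field_simp
    _ ≤ 3 := Real.exp_one_lt_three.le

theorem norm_trace_mul_outputState_le_one {W : RegisterOp n s t} (hW : IsContraction W)
    {α : Fin s → EuclideanSpace ℂ (BitString n)} (hα : Orthonormal ℂ α) :
    ‖Matrix.trace (W * outputState t α)‖ ≤ 1 := by
  have h := norm_sum_outputState_le hW α (fun _ => True) fun _ _ => Iff.rfl
  simp only [if_true] at h
  rw [sum_norm_amplitude_sq hα, Finset.sum_comm] at h
  simpa only [Matrix.trace, Matrix.diag, Matrix.mul_apply] using h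

/-- The defect `1 - δ` enters twice: from the collision part and from the coefficient `δ` in front
of `ρ_uni`. -/
theorem norm_trace_mul_sub_le {W : RegisterOp n s t} (hW : IsContraction W)
    {α : Fin s → EuclideanSpace ℂ (BitString n)} (hα : Orthonormal ℂ α) {c : ℝ}
    (hc : ∑ f : BlockIndex s t → Fin s with 2 ≤ (Finset.univ.filter fun v => f v ≠ v.1).card,
      ‖overlap α f‖ ≤ c) :
    ‖Matrix.trace (W * (outputState t α - uniState n s t))‖ ≤
      2 * (1 - distinctWeight t α) + c := by
  classical
  have hcoll := norm_sum_outputState_le hW α (fun z => ¬Function.Injective z) fun π z =>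
    not_congr (π.injective.of_comp_iff z)
  rw [sum_norm_amplitude_sq_not_injective hα] at hcoll
  rw [Matrix.mul_sub, Matrix.trace_sub, trace_mul_outputState, trace_mul_uniState,
    ← Finset.add_sum_erase Finset.univ _ (Finset.mem_univ (Prod.fst : BlockIndex s t → Fin s)),
    overlap_fst]
  have hfst : ‖((distinctWeight t α : ℂ) - 1) * colourTerm W Prod.fst‖ ≤
      1 - distinctWeight t α := by
    rw [norm_mul]
    have h1 : ‖((distinctWeight t α : ℂ) - 1)‖ = 1 - distinctWeight t α := by
      rw [← Complex.ofReal_one, ← Complex.ofReal_sub, Complex.norm_real, Real.norm_eq_abs,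
        abs_sub_comm, abs_of_nonneg (sub_nonneg.2 (distinctWeight_le_one hα))]
    rw [h1]
    exact mul_le_of_le_one_right (sub_nonneg.2 (distinctWeight_le_one hα))
      (norm_colourTerm_le_one hW _)
  have hrest : ‖∑ f ∈ Finset.univ.erase (Prod.fst : BlockIndex s t → Fin s),
      overlap α f * colourTerm W f‖ ≤ c := by
    refine le_trans ?_ hc
    rw [← Finset.sum_subset (s₁ := (Finset.univ.erase (Prod.fst : BlockIndex s t → Fin s)).filter
      fun f => 2 ≤ (Finset.univ.filter fun v => f v ≠ v.1).card) (Finset.filter_subset _ _)]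
    · refine (norm_sum_le _ _).trans ((Finset.sum_le_sum fun f _ => ?_).trans
        (Finset.sum_le_sum_of_subset_of_nonneg
          (Finset.filter_subset_filter _ (Finset.subset_univ _)) fun _ _ _ => norm_nonneg _))
      rw [norm_mul]
      exact mul_le_of_le_one_right (norm_nonneg _) (norm_colourTerm_le_one hW f)
    · intro f hf hf'
      have hempty : Finset.univ.filter
          (fun τ : Equiv.Perm (BlockIndex s t) => (fun v => (τ.symm v).1) = f) = ∅ :=
        Finset.filter_eq_empty_iff.2 fun τ _ h => hf' (Finset.mem_filter.2
          ⟨hf, two_le_card_recoloured (Finset.ne_of_mem_erase hf) τ h⟩)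
      simp [colourTerm, hempty]
  refine le_trans (le_of_eq (congrArg norm ?_)) ((norm_add₃_le).trans
    (add_le_add (add_le_add hfst hrest) hcoll) |>.trans (le_of_eq ?_))
  · ring
  · ring

theorem one_le_two_pow_mul {ε : ℝ} {α : Fin s → EuclideanSpace ℂ (BitString n)}
    (hα : Orthonormal ℂ α) (hε : ∀ j, IsFlat ε (α j)) (j : Fin s) : 1 ≤ (2 : ℝ) ^ n * ε := by
  rw [← sum_norm_sq_eq_one hα j]
  refine (Finset.sum_le_sum fun x _ => hε j x).trans (le_of_eq ?_)
  simp

theorem norm_trace_mul_sub_le_of_isFlat {W : RegisterOp n s t} (hW : IsContraction W) {ε : ℝ}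
    {α : Fin s → EuclideanSpace ℂ (BitString n)} (hα : Orthonormal ℂ α)
    (hε : ∀ j, IsFlat ε (α j)) :
    ‖Matrix.trace (W * (outputState t α - uniState n s t))‖ ≤
      3 * (((s : ℝ) * t) ^ 2 * ε + (2 : ℝ) ^ n * (s : ℝ) ^ 6 * (t : ℝ) ^ 4 * ε ^ 2) := by
  have hδ := one_sub_le_distinctWeight (t := t) hα hε
  rcases Nat.eq_zero_or_pos (s * t) with hst | hst
  · have hst' : (s : ℝ) * t = 0 := by exact_mod_cast hst
    have h := norm_trace_mul_sub_le hW hα (c := 0) (by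
      rw [Finset.filter_false_of_mem, Finset.sum_empty]
      intro f _ h2
      have := h2.trans (Finset.card_le_univ _)
      simp [hst] at this)
    have h0 : (2 : ℝ) ^ n * (s : ℝ) ^ 6 * (t : ℝ) ^ 4 * ε ^ 2 = 0 := by
      calc _ = (2 : ℝ) ^ n * (s : ℝ) ^ 2 * ((s : ℝ) * t) ^ 4 * ε ^ 2 := by ring
        _ = 0 := by rw [hst']; ring
    rw [h0]
    rw [hst'] at hδ ⊢
    linarith
  have hs : 0 < s := Nat.pos_of_mul_pos_right hst
  have ht : 0 < t := Nat.pos_of_mul_pos_left hst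
  have hN := one_le_two_pow_mul hα hε ⟨0, hs⟩
  have hε0 : 0 < ε := pos_of_mul_pos_right (zero_lt_one.trans_le hN) (by positivity)
  have hs1 : (1 : ℝ) ≤ s := by exact_mod_cast hs
  have ht1 : (1 : ℝ) ≤ t := by exact_mod_cast ht
  set x : ℝ := (s : ℝ) * t * √ε with hx
  -- The factor `s · st` pays for choosing each recoloured position and its new colour.
  set y : ℝ := (s : ℝ) * (s * t) * x with hy
  have hx0 : 0 ≤ x := by positivity
  have hy2 : y ^ 2 = (s : ℝ) ^ 6 * (t : ℝ) ^ 4 * ε := by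
    calc y ^ 2 = (s : ℝ) ^ 6 * (t : ℝ) ^ 4 * √ε ^ 2 := by rw [hy, hx]; ring
      _ = _ := by rw [Real.sq_sqrt hε0.le]
  have hyN : y ^ 2 ≤ (2 : ℝ) ^ n * (s : ℝ) ^ 6 * (t : ℝ) ^ 4 * ε ^ 2 := by
    calc y ^ 2 ≤ ((2 : ℝ) ^ n * ε) * y ^ 2 := le_mul_of_one_le_left (sq_nonneg _) hN
      _ = _ := by rw [hy2]; ring
  have hm : 0 ≤ ((s : ℝ) * t) ^ 2 * ε := by positivity
  rcases le_or_gt y 1 with hy1 | hy1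
  · have hsst : (1 : ℝ) ≤ (s : ℝ) * (s * t) :=
      one_le_mul_of_one_le_of_one_le hs1 (one_le_mul_of_one_le_of_one_le hs1 ht1)
    have hx1 : x ≤ 1 := (le_mul_of_one_le_left hx0 hsst).trans hy1
    have h := norm_trace_mul_sub_le hW hα (c := 3 * y ^ 2) (by
      calc ∑ f : BlockIndex s t → Fin s with 2 ≤ (Finset.univ.filter fun v => f v ≠ v.1).card,
            ‖overlap α f‖
          ≤ ∑ f : BlockIndex s t → Fin s with 2 ≤ (Finset.univ.filter fun v => f v ≠ v.1).card,
            y ^ 2 * (((s : ℝ) * (s * t))⁻¹) ^ (Finset.univ.filter fun v => f v ≠ v.1).card := by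
            refine Finset.sum_le_sum fun f hf => ?_
            have h2 := (Finset.mem_filter.1 hf).2
            refine (norm_overlap_le hε0 hα hε hx1 f).trans ?_
            have hxy : x = y * ((s : ℝ) * (s * t))⁻¹ := by
              rw [hy]
              field_simp
            rw [← hx, hxy, mul_pow]
            exact mul_le_mul_of_nonneg_right
              (pow_le_pow_of_le_one (by positivity) hy1 h2) (by positivity)
        _ ≤ ∑ f : BlockIndex s t → Fin s,
            y ^ 2 * (((s : ℝ) * (s * t))⁻¹) ^ (Finset.univ.filter fun v => f v ≠ v.1).card :=
            Finset.sum_le_sum_of_subset_of_nonneg (Finset.filter_subset _ _)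
              fun _ _ _ => by positivity
        _ ≤ 3 * y ^ 2 := by
            rw [← Finset.mul_sum, mul_comm 3]
            exact mul_le_mul_of_nonneg_left (sum_pow_card_recoloured_le hs ht) (sq_nonneg _))
    linarith
  -- Here `y > 1`, so bounding each of the two traces by 1 is enough.
  · have h1 := norm_trace_mul_outputState_le_one hW hα
    have h2 : ‖Matrix.trace (W * uniState n s t)‖ ≤ 1 :=
      trace_mul_uniState W ▸ norm_colourTerm_le_one hW _
    rw [Matrix.mul_sub, Matrix.trace_sub]
    have h3 := norm_sub_le (Matrix.trace (W * outputState t α)) (Matrix.trace (W * uniState n s t))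
    have : 1 ≤ y ^ 2 := one_le_pow₀ hy1.le
    linarith

end Estimates

theorem lemma4p5 :
    ∃ C : ℝ, 0 < C ∧
      ∀ (n s t : ℕ) (ε : ℝ) (α : Fin s → EuclideanSpace ℂ (BitString n)),
        Orthonormal ℂ α → (∀ j : Fin s, IsFlat ε (α j)) →
          traceNorm (outputState t α - uniState n s t) ≤
            C * (((s : ℝ) * (t : ℝ)) ^ 2 * ε +
              (2 : ℝ) ^ n * (s : ℝ) ^ 6 * (t : ℝ) ^ 4 * ε ^ 2) := by
  refine ⟨3, by norm_num, fun n s t ε α hα hε => ?_⟩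
  obtain ⟨W, hW, h⟩ := exists_isContraction_traceNorm (outputState t α - uniState n s t)
  rw [h]
  exact ((Complex.re_le_norm _).trans (norm_trace_mul_sub_le_of_isFlat hW hα hε))
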